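/- Let $H$ be an infinite-dimensional separable complex Hilbert space with inner product $(\cdot,\cdot)$, $H^1\subset H$ a dense subspace, $\mathbf a[\cdot,\cdot]$ the Hermitian sesquilinear form of a closed positive definite quadratic form on $H^1$ (i.e. $\mathbf a[u,u]\ge c\|u\|^2$ on $H^1$ for some $c>0$), and let $H^1_0\subset H^1$ be a subspace which is closed with respect to the norm $\mathbf a[u,u]^{1/2}$ and dense in $H$. Let $A_{\mathrm N}$ and $A_{\mathrm D}$ be the self-adjoint operators in $H$ generated by $\mathbf a$ on $H^1$ and on $H^1_0$ respectively. Let $H^1_A$ be the set of $u\in H^1$ such that the functional $v\mapsto\mathbf a[u,v]$ on $H^1_0$ is continuous in the norm of $H$, and let $A:H^1_A\to H$ be the operator defined by $(Au,v)=\mathbf a[u,v]$ for all $v\in H^1_0$. Put $G_\lambda=\{u\in H^1_A: Au=\lambda u\}$ and $\mathbf b[u]=\mathbf a[u,u]-(Au,u)$ for $u\in H^1_A$. For $\mathrm B\in\{\mathrm N,\mathrm D\}$ and $\lambda\in\mathbb R\setminus\sigma_{\mathrm{ess}}(A_{\mathrm B})$ let $E'_{\mathrm B}(\lambda)$ be the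 orthogonal projection of $H$ onto $\ker(A_{\mathrm B}-\lambda I)^{\perp}$, and put $$P'_{\mathrm B}(\lambda)=I-(A_{\mathrm B}-\lambda I)^{-1}E'_{\mathrm B}(\lambda)\,(A-\lambda I)\quad\text{on }H^1_A,$$ where $(A_{\mathrm B}-\lambda I)^{-1}E'_{\mathrm B}(\lambda)f$ denotes the unique $u\in\mathcal D(A_{\mathrm B})$ orthogonal to $\ker(A_{\mathrm B}-\lambda I)$ with $(A_{\mathrm B}-\lambda I)u=E'_{\mathrm B}(\lambda)f$. Let $\Lambda\subset\mathbb R$ be an arbitrary interval and let $v\in H^1_A$. (1) If $\Lambda\cap\sigma_{\mathrm{ess}}(A_{\mathrm N})=\varnothing$ and $\chi_\Lambda(A_{\mathrm N})P'_{\mathrm N}(0)v=0$, where $\chi_\Lambda(A_{\mathrm N})$ is the spectral projection of $A_{\mathrm N}$ for $\Lambda$, then $P'_{\mathrm N}(\lambda)v\in G_\lambda$ for all $\lambda\in\Lambda$, and $\lambda\mapsto\mathbf b[P'_{\mathrm N}(\lambda)v]$ is a real-valued nondecreasing function on $\Lambda$. If, in addition, $v\notin\mathcal D(A_{\mathrm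 N})$, this function is strictly increasing on $\Lambda$. (2) If $\Lambda\cap\sigma_{\mathrm{ess}}(A_{\mathrm D})=\varnothing$ and $\chi_\Lambda(A_{\mathrm D})P'_{\mathrm D}(0)v=0$, then $P'_{\mathrm D}(\lambda)v\in G_\lambda$ for all $\lambda\in\Lambda$, and $\lambda\mapsto\mathbf b[P'_{\mathrm D}(\lambda)v]$ is a real-valued nonincreasing function on $\Lambda$. If, in addition, $v\notin\mathcal D(A_{\mathrm D})$, this function is strictly decreasing on $\Lambda$. -/

import Mathlib

noncomputable section

namespace DirichletNeumann

open MeasureTheory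

variable {H : Type*} [NormedAddCommGroup H] [InnerProductSpace ℂ H]

/-! ### Unbounded operators in a Hilbert space -/

/-- `ker (T - z I)` for an unbounded operator `T`. -/
def eigenspace (T : H →ₗ.[ℂ] H) (z : ℂ) : Submodule ℂ H where
  carrier := {u | ∃ hu : u ∈ T.domain, T ⟨u, hu⟩ = z • u}
  add_mem' := by
    rintro u v ⟨hu, hu'⟩ ⟨hv, hv'⟩
    refine ⟨T.domain.add_mem hu hv, ?_⟩
    have := T.map_add ⟨u, hu⟩ ⟨v, hv⟩
    rw [hu', hv', ← smul_add] at this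
    exact this
  zero_mem' := ⟨T.domain.zero_mem, by
    have := T.map_zero
    rw [smul_zero]
    exact this⟩
  smul_mem' := by
    rintro c u ⟨hu, hu'⟩
    refine ⟨T.domain.smul_mem c hu, ?_⟩
    have := T.map_smul c ⟨u, hu⟩
    rw [hu', smul_comm] at this
    exact this

/-- `z` belongs to the resolvent set of `T`: the operator `T - z I : D(T) → H` is bijective and has
a bounded inverse. -/
def InResolventSet (T : H →ₗ.[ℂ] H) (z : ℂ) : Prop :=
  ∃ R : H →L[ℂ] H, (∀ f : H, ∃ u : T.domain, (u : H) = R f ∧ T u - z • (u : H) = f) ∧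
    ∀ u : T.domain, R (T u - z • (u : H)) = u

/-- The spectrum of a self-adjoint operator, as a set of real numbers. -/
def realSpectrum (T : H →ₗ.[ℂ] H) : Set ℝ := {t | ¬ InResolventSet T (t : ℂ)}

/-- The discrete spectrum: isolated points of the spectrum which are eigenvalues of finite
multiplicity. -/
def discreteSpectrum (T : H →ₗ.[ℂ] H) : Set ℝ :=
  {t | t ∈ realSpectrum T ∧ (∃ ε > 0, ∀ s ∈ realSpectrum T, |s - t| < ε → s = t) ∧
    eigenspace T (t : ℂ) ≠ ⊥ ∧ FiniteDimensional ℂ (eigenspace T (t : ℂ))}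

/-- The essential spectrum of a self-adjoint operator. -/
def essentialSpectrum (T : H →ₗ.[ℂ] H) : Set ℝ := realSpectrum T \ discreteSpectrum T

/-- `μ` is the spectral measure of the self-adjoint operator `T` at the vector `w`, i.e. the finite
Borel measure on `ℝ` whose Borel (Stieltjes) transform is `z ↦ (w, (T - z)⁻¹ w)`. -/
def IsSpectralMeasure (T : H →ₗ.[ℂ] H) (w : H) (μ : Measure ℝ) : Prop :=
  IsFiniteMeasure μ ∧ ∀ z : ℂ, z.im ≠ 0 →
    ∃ u : T.domain, T u - z • (u : H) = w ∧ inner ℂ w (u : H) = ∫ s : ℝ, ((s : ℂ) - z)⁻¹ ∂μ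

/-- The orthogonal projection onto the closure of the subspace `S`
(onto `S` itself if `S` is closed). -/
def orthProj [CompleteSpace H] (S : Submodule ℂ H) : H →L[ℂ] H := S.topologicalClosure.starProjection

/-- The spectral projection `χ_Λ(T)` of the self-adjoint operator `T` for a Borel set `Λ ⊆ ℝ`:
the orthogonal projection onto the subspace of all `w` whose spectral measure is carried by `Λ`.
(For a self-adjoint operator the set of these `w` is already a closed subspace, so that taking
the closed span does not change it.) -/
def spectralProjection [CompleteSpace H] (T : H →ₗ.[ℂ] H) (Λ : Set ℝ) : H →L[ℂ] H :=
  orthProj (Submodule.span ℂ {w : H | ∃ μ : Measure ℝ, IsSpectralMeasure T w μ ∧ μ Λᶜ = 0})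

/-- `E(z)`, the orthogonal projection onto `ker (T - z I)`. -/
def kerProj [CompleteSpace H] (T : H →ₗ.[ℂ] H) (z : ℂ) : H →L[ℂ] H := orthProj (eigenspace T z)

open Classical in
/-- The operator `(T - z I)⁻¹ E'(z)`, where `E'(z) = I - E(z)`: it sends `f` to the unique
`u ∈ D(T)` orthogonal to `ker (T - z I)` with `(T - z I) u = E'(z) f`. Such a `u` exists for every
`f` if `T` is self-adjoint and `z` is not in its essential spectrum (otherwise the value may
be the junk value `0`). -/
def reducedResolvent [CompleteSpace H] (T : H →ₗ.[ℂ] H) (z : ℂ) (f : H) : T.domain :=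
  if h : ∃ u : T.domain, (u : H) ∈ (eigenspace T z)ᗮ ∧ T u - z • (u : H) = f - kerProj T z f
  then h.choose else 0

/-! ### The pair of quadratic forms -/

variable (H) in
/-- A closed positive (definite) quadratic form `a` on a dense subspace `H1` of `H`, given by the
corresponding sesquilinear form (conjugate-linear in the first argument, as the inner product),
and a subspace `H01` of `H1`, closed in `H1` with respect to the norm `a[·]^{1/2}` and
dense in `H`. -/
structure FormPair where
  /-- the domain of the form -/
  H1 : Submodule ℂ H
  dense_H1 : Dense (H1 : Set H)
  /-- the sesquilinear form -/
  a : H1 →ₗ⋆[ℂ] H1 →ₗ[ℂ] ℂ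
  hermitian : ∀ u v : H1, a u v = star (a v u)
  positive : ∃ c > 0, ∀ u : H1, c * ‖(u : H)‖ ^ 2 ≤ (a u u).re
  closed : ∀ (x : ℕ → H1) (y : H), Filter.Tendsto (fun n => (x n : H)) Filter.atTop (nhds y) →
    (∀ ε > 0, ∃ N, ∀ m ≥ N, ∀ n ≥ N, (a (x m - x n) (x m - x n)).re < ε) →
    ∃ u : H1, (u : H) = y ∧
      Filter.Tendsto (fun n => (a (x n - u) (x n - u)).re) Filter.atTop (nhds 0)
  /-- the smaller subspace `H^1_0` -/
  H01 : Submodule ℂ H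
  H01_le : H01 ≤ H1
  dense_H01 : Dense (H01 : Set H)
  closed_H01 : ∀ (x : ℕ → H1) (u : H1), (∀ n, (x n : H) ∈ H01) →
    Filter.Tendsto (fun n => (a (x n - u) (x n - u)).re) Filter.atTop (nhds 0) → (u : H) ∈ H01

/-- The label `B`, which stands for either `N` (Neumann) or `D` (Dirichlet). -/
inductive BC
  | N
  | D

namespace FormPair

variable (F : FormPair H)

/-- The graph of the operator that the form defines on vectors from `Q ∩ H1` by means of test
vectors from `V ∩ H1`: all `(u, f)` with `u ∈ Q ∩ H1` and `a[u, v] = (f, v)` for all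
`v ∈ V ∩ H1`. -/
def formGraph (Q V : Submodule ℂ H) : Submodule ℂ (H × H) where
  carrier := {p | p.1 ∈ Q ∧ ∃ hp : p.1 ∈ F.H1, ∀ v : F.H1, (v : H) ∈ V →
    F.a ⟨p.1, hp⟩ v = inner ℂ p.2 (v : H)}
  add_mem' := by
    rintro p q ⟨hpQ, hp, hp'⟩ ⟨hqQ, hq, hq'⟩
    refine ⟨Q.add_mem hpQ hqQ, F.H1.add_mem hp hq, fun v hv => ?_⟩
    have h : (⟨(p + q).1, F.H1.add_mem hp hq⟩ : F.H1) = ⟨p.1, hp⟩ + ⟨q.1, hq⟩ := rfl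
    rw [h, map_add, LinearMap.add_apply, hp' v hv, hq' v hv, Prod.snd_add, inner_add_left]
  zero_mem' := by
    refine ⟨Q.zero_mem, F.H1.zero_mem, fun v hv => ?_⟩
    have h : (⟨(0 : H × H).1, F.H1.zero_mem⟩ : F.H1) = 0 := rfl
    rw [h, map_zero, LinearMap.zero_apply, Prod.snd_zero, inner_zero_left]
  smul_mem' := by
    rintro c p ⟨hpQ, hp, hp'⟩
    refine ⟨Q.smul_mem c hpQ, F.H1.smul_mem c hp, fun v hv => ?_⟩
    have h : (⟨(c • p).1, F.H1.smul_mem c hp⟩ : F.H1) = c • ⟨p.1, hp⟩ := rfl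
    rw [h, map_smulₛₗ, LinearMap.smul_apply, hp' v hv, Prod.smul_snd, inner_smul_left]
    rfl

/-- The operator with the graph `formGraph Q V`. -/
def formOperator (Q V : Submodule ℂ H) : H →ₗ.[ℂ] H := (F.formGraph Q V).toLinearPMap

/-- The form domain of `A_B`: `H^1` for `B = N`, and `H^1_0` for `B = D`. -/
def formDomain : BC → Submodule ℂ H
  | .N => F.H1
  | .D => F.H01

/-- The self-adjoint operator `A_B` in `H` generated by the form `a` on `H^1` (`B = N`)
or by the restriction of the form `a` to `H^1_0` (`B = D`). -/
def opB (B : BC) : H →ₗ.[ℂ] H := F.formOperator (F.formDomain B) (F.formDomain B)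

/-- The operator `A`. Its domain `H_A^1` consists of all `u ∈ H^1` such that the functional
`v ↦ a[u, v]` on `H^1_0` is `H`-continuous, and `(A u, v) = a[u, v]` for all `v ∈ H^1_0`. -/
def opA : H →ₗ.[ℂ] H := F.formOperator F.H1 F.H01

theorem graph_formOperator (Q V : Submodule ℂ H) (hV : V ≤ F.H1) (hd : Dense (V : Set H)) :
    (F.formOperator Q V).graph = F.formGraph Q V := by
  refine Submodule.toLinearPMap_graph_eq _ ?_
  rintro ⟨u, f⟩ ⟨_, hu, h⟩ (rfl : u = 0)
  refine hd.eq_zero_of_inner_left ℂ fun v hv => ?_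
  have h0 : (⟨0, hu⟩ : F.H1) = 0 := rfl
  have h1 := h ⟨v, hV hv⟩ hv
  simpa [h0] using h1.symm

/-- The description of `H_A^1` through continuous functionals. -/
theorem mem_domain_opA_iff [CompleteSpace H] (u : H) :
    u ∈ F.opA.domain ↔ ∃ hu : u ∈ F.H1, ∃ C : ℝ, ∀ v : F.H1, (v : H) ∈ F.H01 →
      ‖F.a ⟨u, hu⟩ v‖ ≤ C * ‖(v : H)‖ := by
  constructor
  · rintro ⟨⟨u', f⟩, ⟨_, hu, h⟩, (rfl : u' = u)⟩
    refine ⟨hu, ‖f‖, fun v hv => ?_⟩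
    rw [h v hv]
    exact norm_inner_le_norm _ _
  · rintro ⟨hu, C, h⟩
    let L : F.H01 →L[ℂ] ℂ := LinearMap.mkContinuous
      ((F.a ⟨u, hu⟩).comp (Submodule.inclusion F.H01_le)) C fun v => h ⟨v, F.H01_le v.2⟩ v.2
    obtain ⟨g, hg, -⟩ := exists_extension_norm_eq F.H01 L
    refine ⟨(u, (InnerProductSpace.toDual ℂ H).symm g), ⟨hu, hu, fun v hv => ?_⟩, rfl⟩
    have h1 := hg ⟨v, hv⟩
    simp only [InnerProductSpace.toDual_symm_apply]
    exact h1.symm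

theorem domain_opA_le : F.opA.domain ≤ F.H1 := by
  rintro u ⟨p, ⟨hp, _⟩, rfl⟩
  exact hp

theorem domain_opB_le (B : BC) : (F.opB B).domain ≤ F.opA.domain := by
  rintro u ⟨p, ⟨hpQ, hp, h⟩, rfl⟩
  refine ⟨p, ⟨hp, hp, fun v hv => h v ?_⟩, rfl⟩
  cases B
  · exact v.2
  · exact hv

/-- `G_z = {u ∈ H_A^1 : A u = z u}`. -/
def G (z : ℂ) : Submodule ℂ H := eigenspace F.opA z

/-- `b[u, v] = a[u, v] - (A u, v)` for `u ∈ H_A^1` and `v ∈ H^1`. -/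
def b (u : F.opA.domain) (v : F.H1) : ℂ :=
  F.a ⟨u, F.domain_opA_le u.2⟩ v - inner ℂ (F.opA u) (v : H)

/-- `b[u] = b[u, u]` for `u ∈ H_A^1`. -/
def bq (u : F.opA.domain) : ℂ := F.b u ⟨u, F.domain_opA_le u.2⟩

/-- `P_B(z) = R_B(z) E'_B(z) (A - z I) : H_A^1 → H_A^1`, for `z` outside the essential spectrum
of `A_B`. -/
def P [CompleteSpace H] (B : BC) (z : ℂ) (v : F.opA.domain) : F.opA.domain :=
  Submodule.inclusion (F.domain_opB_le B)
    (reducedResolvent (F.opB B) z (F.opA v - z • (v : H)))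

/-- `P'_B(z) = I - P_B(z) : H_A^1 → H_A^1`. -/
def P' [CompleteSpace H] (B : BC) (z : ℂ) (v : F.opA.domain) : F.opA.domain := v - F.P B z v

end FormPair

end DirichletNeumann

end

noncomputable section

namespace DirichletNeumann

open MeasureTheory Filter Topology

variable {H : Type*} [NormedAddCommGroup H] [InnerProductSpace ℂ H]

/-! ### Bounded self-adjoint operators -/

/-! Put $w = P'_B(0)v$, so that $Aw = 0$. The spectral hypothesis makes $w$ orthogonal to $\ker(A_B
- t)$ for every $t \in \Lambda$, which gives $P'_B(t)v = u_t := w + k_t$ with $k_t \in D(A_B)$ and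
$(A_B - t)k_t = tw$. Hence $Au_t = tu_t$. Expanding the form gives $b[u_t] = a[w,w] + t(w,u_t)$ for
Neumann and $a[w,w] - t(u_t,w)$ for Dirichlet (`bq_neumann`, `bq_dirichlet`); this sign is the only
difference between the two cases.

Everything thus rests on $\varphi(t) = t(w,u_t)$, which is real. Symmetry of $A_B$ yields
$\varphi(t) - \varphi(s) = (t-s)\,\mathrm{Re}(u_s,u_t)$ (`mul_inner_sub_mul_inner`), so $\varphi' =
\|u_t\|^2$ once $t \mapsto u_t$ is continuous. Eigenvalues inside $\Lambda$ are allowed: with $k_t$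
chosen orthogonal to the kernel, continuity follows from a bound for the reduced resolvent at the
single point $t$ (`exists_reduced_resolvent`). If $w \ne 0$, then $u_t \ne 0$ and $\varphi$
increases strictly; if $w = 0$, then $v \in D(A_B)$ and $\varphi = 0$. -/

/-- If `μ` is not an accumulation point of the spectrum of the bounded self-adjoint operator `B`,
then `B - μ` has a bounded inverse on the orthogonal complement of its kernel. -/
theorem exists_pseudoinverse [CompleteSpace H] {B : H →L[ℂ] H} (hB : IsSelfAdjoint B) {μ : ℝ}
    (hμ : ∃ ε > 0, ∀ s ∈ spectrum ℝ B, |s - μ| < ε → s = μ) :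
    ∃ C : H →L[ℂ] H, (∀ x : H, C (B x - (μ : ℂ) • x) = B (C x) - (μ : ℂ) • C x) ∧
      ∀ x : H, (∀ e : H, B e = (μ : ℂ) • e → inner ℂ e x = 0) →
        B (C x) - (μ : ℂ) • C x = x ∧ ∀ e : H, B e = (μ : ℂ) • e → inner ℂ e (C x) = 0 := by
  obtain ⟨ε, hε, hμ⟩ := hμ
  -- The spectrum has no other point near $\mu$, so a jump of $g$ at $\mu$ does not affect
  -- continuity on it.
  have hcont (g : ℝ → ℝ) (hg : ∀ s ≠ μ, ContinuousAt g s) : ContinuousOn g (spectrum ℝ B) := by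
    intro s hs
    by_cases h : s = μ
    · subst h
      have : ∀ᶠ x in 𝓝[spectrum ℝ B] s, g x = g s := by
        filter_upwards [self_mem_nhdsWithin,
          mem_nhdsWithin_of_mem_nhds (Metric.ball_mem_nhds s hε)] with x hx hxs
        rw [hμ x hx (by simpa [Real.dist_eq] using hxs)]
      exact (continuousWithinAt_const (b := g s)).congr_of_eventuallyEq this rfl
    · exact (hg s h).continuousWithinAt
  -- Since `0⁻¹ = 0`, $f(\mu) = 0$ and $q$ is the indicator of $s \ne \mu$. Thus $Q = q(B)$ projects
  -- off the kernel of $B - \mu$, and $C = f(B)$ inverts $B - \mu$ on the range of $Q$.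
  set f : ℝ → ℝ := fun s => (s - μ)⁻¹ with hf
  set q : ℝ → ℝ := fun s => f s * (s - μ) with hq
  have hfc : ContinuousOn f (spectrum ℝ B) := hcont f fun s hs => by
    have : s - μ ≠ 0 := sub_ne_zero.2 hs
    fun_prop (disch := assumption)
  have hdc : ContinuousOn (fun s : ℝ => s - μ) (spectrum ℝ B) := by fun_prop
  have hqc : ContinuousOn q (spectrum ℝ B) := hfc.mul hdc
  set C := cfc f B with hC
  set Q := cfc q B with hQ
  have hD (x : H) : cfc (fun s : ℝ => s - μ) B x = B x - (μ : ℂ) • x := by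
    rw [cfc_sub (fun s : ℝ => s) (fun _ => μ) B, cfc_id' ℝ B, cfc_const μ B]
    simp [Algebra.algebraMap_eq_smul_one]
  have hCD (x : H) : C (B x - (μ : ℂ) • x) = Q x := by
    rw [← hD, hQ, hq, cfc_mul f (fun s => s - μ) B]; rfl
  have hDC (x : H) : B (C x) - (μ : ℂ) • C x = Q x := by
    rw [← hD, hQ, hq, cfc_congr (g := fun s => (s - μ) * f s) (fun s _ => mul_comm _ _),
      cfc_mul (fun s => s - μ) f B]; rfl
  have hDQ (x : H) : B (Q x) - (μ : ℂ) • Q x = B x - (μ : ℂ) • x := by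
    rw [← hD, ← hD, hQ, ← mul_apply_eq_comp, ← cfc_mul (fun s => s - μ) q B]
    congr 1
    refine cfc_congr fun s _ => ?_
    by_cases h : s = μ
    · simp [hq, hf, h]
    · have : s - μ ≠ 0 := sub_ne_zero.2 h
      simp only [hq, hf]; field_simp
  have hQQ (x : H) : Q (Q x) = Q x := by
    rw [← hCD, hDQ, hCD]
  have hsaQ : IsSelfAdjoint Q := cfc_predicate q B
  have hsaC : IsSelfAdjoint C := cfc_predicate f B
  refine ⟨C, fun x => by rw [hCD, hDC], fun x hx => ⟨?_, fun e he => ?_⟩⟩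
  -- The vector $x - Qx$ lies in the kernel and is orthogonal to both $x$ and $Qx$, so it vanishes.
  · have h1 : B (x - Q x) = (μ : ℂ) • (x - Q x) := by
      have := hDQ x
      rw [map_sub, smul_sub]
      linear_combination (norm := module) -this
    have h2 : inner ℂ (x - Q x) (x - Q x) = 0 := by
      have h3 : inner ℂ (x - Q x) (Q x) = 0 := by
        refine (hsaQ.isSymmetric (x - Q x) x).symm.trans ?_
        simp [hQQ]
      rw [inner_sub_right, hx _ h1, h3, sub_zero]
    rw [hDC]
    exact (sub_eq_zero.1 (inner_self_eq_zero.1 h2)).symm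
  · have h1 : B (C e) = (μ : ℂ) • C e := by
      rw [← sub_eq_zero, hDC, ← hCD, he, sub_self, map_zero]
    exact (hsaC.isSymmetric e x).symm.trans (hx _ h1)

/-! ### Symmetric operators with bounded inverse -/

section Symmetric

variable {T : H →ₗ.[ℂ] H}

theorem mem_eigenspace_coe {z : ℂ} (u : T.domain) :
    (u : H) ∈ eigenspace T z ↔ T u = z • (u : H) :=
  ⟨fun ⟨_, h⟩ => h, fun h => ⟨u.2, h⟩⟩

/-- Solvability of `(T - t) u = f` on the orthogonal complement of the kernel, with a bound, for
real `t` outside the essential spectrum. -/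
theorem exists_reduced_resolvent [CompleteSpace H]
    (hT : ∀ u v : T.domain, inner ℂ (T u) (v : H) = inner ℂ (u : H) (T v))
    (h0 : InResolventSet T 0) {t : ℝ} (ht : t ∉ essentialSpectrum T) :
    ∃ K : ℝ, 0 ≤ K ∧
      (∀ f ∈ (eigenspace T (t : ℂ))ᗮ, ∃ u : T.domain, (u : H) ∈ (eigenspace T (t : ℂ))ᗮ ∧
        T u - (t : ℂ) • (u : H) = f) ∧
      ∀ u : T.domain, (u : H) ∈ (eigenspace T (t : ℂ))ᗮ →
        ‖(u : H)‖ ≤ K * ‖T u - (t : ℂ) • (u : H)‖ := by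
  by_cases hres : InResolventSet T (t : ℂ)
  · obtain ⟨R, hR, hR'⟩ := hres
    have hker : eigenspace T (t : ℂ) = ⊥ := by
      rw [eq_bot_iff]
      rintro x ⟨hx, hx'⟩
      have := hR' ⟨x, hx⟩
      rw [hx', sub_self, map_zero] at this
      exact this.symm
    refine ⟨‖R‖, norm_nonneg _, fun f _ => ?_, fun u _ => ?_⟩
    · obtain ⟨u, -, hu⟩ := hR f
      exact ⟨u, by simp [hker], hu⟩
    · conv_lhs => rw [← hR' u]
      exact R.le_opNorm _
  have hdisc : t ∈ discreteSpectrum T := by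
    by_contra h
    exact ht ⟨hres, h⟩
  obtain ⟨-, ⟨ε, hε, hiso⟩, -, -⟩ := hdisc
  have ht0 : t ≠ 0 := by
    rintro rfl
    exact hres (by simpa using h0)
  have htc : (t : ℂ) ≠ 0 := by exact_mod_cast ht0
  -- Pass to the bounded self-adjoint $R = T^{-1}$: the eigenspace of $T$ at $t$ is that of $R$ at
  -- $t^{-1}$, and $t^{-1}$ inherits isolation.
  obtain ⟨R, hR, hR'⟩ := h0
  choose r hr hTr using hR
  simp only [zero_smul, sub_zero] at hTr hR'
  have hsa : IsSelfAdjoint R := by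
    rw [ContinuousLinearMap.isSelfAdjoint_iff_isSymmetric]
    intro x y
    have := hT (r x) (r y)
    rw [hTr, hTr, hr, hr] at this
    exact this.symm
  have hker (e : H) : R e = ((t⁻¹ : ℝ) : ℂ) • e ↔ e ∈ eigenspace T (t : ℂ) := by
    push_cast
    constructor
    · intro h
      have he : e = (t : ℂ) • R e := by rw [h, smul_smul, mul_inv_cancel₀ htc, one_smul]
      have h1 : e = (((t : ℂ) • r e : T.domain) : H) := by
        rw [Submodule.coe_smul, hr]; exact he
      rw [h1, mem_eigenspace_coe, ← h1, T.map_smul, hTr]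
    · rintro ⟨he, he'⟩
      have := hR' ⟨e, he⟩
      rw [he', map_smul] at this
      rw [eq_inv_smul_iff₀ htc]
      exact this
  have hisoR : ∃ δ > 0, ∀ s ∈ spectrum ℝ R, |s - t⁻¹| < δ → s = t⁻¹ := by
    have hc : ContinuousAt (fun s : ℝ => s⁻¹) t⁻¹ := continuousAt_inv₀ (inv_ne_zero ht0)
    have h1 : ∀ᶠ s in 𝓝 t⁻¹, |s⁻¹ - t| < ε := by
      have := hc.eventually (Metric.ball_mem_nhds _ hε)
      simpa [Real.dist_eq] using this
    have h2 : ∀ᶠ s in 𝓝 t⁻¹, s ≠ 0 := isOpen_ne.mem_nhds (inv_ne_zero ht0)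
    obtain ⟨δ, hδ, h⟩ := Metric.eventually_nhds_iff.1 (h1.and h2)
    refine ⟨δ, hδ, fun s hs hst => ?_⟩
    obtain ⟨hs1, hs2⟩ := h (by simpa [Real.dist_eq] using hst)
    by_contra hne
    have hres' : InResolventSet T ((s⁻¹ : ℝ) : ℂ) := by
      by_contra hcon
      exact hne (by rw [← hiso _ hcon hs1, inv_inv])
    have hsc : (s : ℂ) ≠ 0 := by exact_mod_cast hs2
    obtain ⟨S, hS, hS'⟩ := hres'
    push_cast at hS hS'
    refine hs ?_
    have hunit : IsUnit ((1 : H →L[ℂ] H) - (s : ℂ)⁻¹ • R) := by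
      -- With $S = (T - s^{-1})^{-1}$, the inverse of $1 - s^{-1}R = (T - s^{-1})R$ is $TS = 1 +
      -- s^{-1}S$.
      refine ⟨⟨1 - (s : ℂ)⁻¹ • R, 1 + (s : ℂ)⁻¹ • S, ?_, ?_⟩, rfl⟩
      · ext f
        obtain ⟨u, hu, hu'⟩ := hS f
        have h3 : R f = (u : H) - (s : ℂ)⁻¹ • R u := by
          rw [← hu', map_sub, hR', map_smul]
        simp only [mul_apply_eq_comp, sub_apply,
          add_apply, smul_apply,
          one_apply_eq_self, map_add, map_smul, ← hu, h3]
        module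
      · ext f
        have h3 := hS' (r f)
        rw [hTr, hr] at h3
        simp only [mul_apply_eq_comp, sub_apply,
          add_apply, smul_apply,
          one_apply_eq_self, h3]
        module
    have h4 : algebraMap ℝ (H →L[ℂ] H) s - R = (s : ℂ) • (1 - (s : ℂ)⁻¹ • R) := by
      ext x
      simp [Algebra.algebraMap_eq_smul_one, smul_sub, smul_smul, hsc]
    show IsUnit (algebraMap ℝ (H →L[ℂ] H) s - R)
    rw [h4]
    exact hunit.smul (Units.mk0 (s : ℂ) hsc)
  obtain ⟨C, hC, hC'⟩ := exists_pseudoinverse hsa hisoR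
  have horth (x : H) (hx : x ∈ (eigenspace T (t : ℂ))ᗮ) (e : H)
      (he : R e = ((t⁻¹ : ℝ) : ℂ) • e) : inner ℂ e x = 0 := hx e ((hker e).1 he)
  have horthR (x : H) (hx : x ∈ (eigenspace T (t : ℂ))ᗮ) (e : H)
      (he : R e = ((t⁻¹ : ℝ) : ℂ) • e) : inner ℂ e (R x) = 0 := by
    have := hsa.isSymmetric e x
    simp only [ContinuousLinearMap.coe_coe] at this
    rw [← this, he, inner_smul_left, horth x hx e he, mul_zero]
  refine ⟨‖C‖ * (‖(t : ℂ)⁻¹‖ * ‖R‖), by positivity, fun f hf => ?_, fun u hu => ?_⟩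
  · obtain ⟨h1, h2⟩ := hC' (R f) (horthR f hf)
    set y := C (R f) with hy
    -- From $Ry - t^{-1}y = Rf$ it follows that $(T - t)R(f - y) = f - y + t(Ry - Rf) = f$.
    refine ⟨r (f - y), fun e he => ?_, ?_⟩
    · rw [hr]
      refine horthR _ (Submodule.sub_mem _ hf fun e he => ?_) e ((hker e).2 he)
      exact h2 e ((hker e).2 he)
    · push_cast at h1
      have h3 : R y - R f = (t : ℂ)⁻¹ • y := by
        rw [sub_eq_iff_eq_add, add_comm, ← sub_eq_iff_eq_add, h1]
      rw [hTr, hr, map_sub]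
      have h4 : (t : ℂ) • (R f - R y) = - y := by
        rw [← neg_sub (R y), h3, smul_neg, smul_smul, mul_inv_cancel₀ htc, one_smul]
      rw [h4]; abel
  · have h1 := (hC' u (horth u hu)).1
    rw [← hC] at h1
    have h2 : R u - ((t⁻¹ : ℝ) : ℂ) • (u : H) = -((t : ℂ)⁻¹ • R (T u - (t : ℂ) • (u : H))) := by
      push_cast
      rw [map_sub, hR', map_smul, smul_sub, smul_smul, inv_mul_cancel₀ htc, one_smul]
      abel
    calc ‖(u : H)‖ = ‖C (R u - ((t⁻¹ : ℝ) : ℂ) • (u : H))‖ := by rw [h1]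
      _ ≤ ‖C‖ * ‖R u - ((t⁻¹ : ℝ) : ℂ) • (u : H)‖ := C.le_opNorm _
      _ ≤ ‖C‖ * (‖(t : ℂ)⁻¹‖ * (‖R‖ * ‖T u - (t : ℂ) • (u : H)‖)) := by
        rw [h2, norm_neg, norm_smul]
        gcongr
        exact R.le_opNorm _
      _ = _ := by ring

theorem sub_kerProj_mem_orthogonal [CompleteSpace H] (z : ℂ) (f : H) :
    f - kerProj T z f ∈ (eigenspace T z)ᗮ :=
  Submodule.orthogonal_le (Submodule.le_topologicalClosure _)
    (Submodule.sub_starProjection_mem_orthogonal f)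

theorem orthProj_eq_zero_iff [CompleteSpace H] (S : Submodule ℂ H) (f : H) :
    orthProj S f = 0 ↔ f ∈ Sᗮ := by
  rw [orthProj, Submodule.starProjection_apply_eq_zero_iff, Submodule.orthogonal_closure]

/-- Outside the essential spectrum the equation is solvable, so the junk value in `reducedResolvent`
does not occur. -/
theorem reducedResolvent_spec [CompleteSpace H]
    (hT : ∀ u v : T.domain, inner ℂ (T u) (v : H) = inner ℂ (u : H) (T v))
    (h0 : InResolventSet T 0) {t : ℝ} (ht : t ∉ essentialSpectrum T) (f : H) :
    T (reducedResolvent T t f) - (t : ℂ) • (reducedResolvent T t f : H) =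
      f - kerProj T t f := by
  obtain ⟨K, -, h, -⟩ := exists_reduced_resolvent hT h0 ht
  have h1 := h _ (sub_kerProj_mem_orthogonal (t : ℂ) f)
  rw [reducedResolvent, dif_pos h1]
  exact h1.choose_spec.2

/-- The kernel of the spectral projection for `Λ` is orthogonal to the eigenspaces for `t ∈ Λ`. -/
theorem mem_orthogonal_eigenspace_of_spectralProjection_eq_zero [CompleteSpace H] {Λ : Set ℝ}
    {w : H} (hw : spectralProjection T Λ w = 0) {t : ℝ} (ht : t ∈ Λ) :
    w ∈ (eigenspace T (t : ℂ))ᗮ := by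
  rw [spectralProjection, orthProj_eq_zero_iff] at hw
  rintro e ⟨he, he'⟩
  -- An eigenvector $e$ at $t$ has spectral measure $\|e\|^2\delta_t$, which is carried by
  -- $\Lambda$.
  refine hw e (Submodule.subset_span ⟨ENNReal.ofReal (‖e‖ ^ 2) • Measure.dirac t,
    ⟨⟨by simp⟩, fun z hz => ?_⟩, ?_⟩)
  · have hne : (t : ℂ) - z ≠ 0 := fun h => hz (by
      rw [← sub_eq_zero.1 h]; simp)
    refine ⟨((t : ℂ) - z)⁻¹ • ⟨e, he⟩, ?_, ?_⟩
    · rw [T.map_smul, he', Submodule.coe_smul, smul_smul, smul_smul, ← sub_smul,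
        mul_comm z, ← mul_sub, inv_mul_cancel₀ hne, one_smul]
    · rw [Submodule.coe_smul, inner_smul_right, integral_smul_measure, integral_dirac,
        ENNReal.toReal_ofReal (by positivity), inner_self_eq_norm_sq_to_K, Complex.real_smul]
      push_cast
      exact mul_comm _ _
  · simp [ht]

/-- Pairing the equation for $k$ with $e$ gives $(t - s)(e,k) = 0$. This puts the solutions at
neighbouring parameters $s$ into the subspace where the reduced resolvent bound at $t$ applies. -/
theorem inner_eq_zero_of_mem_eigenspace
    (hT : ∀ u v : T.domain, inner ℂ (T u) (v : H) = inner ℂ (u : H) (T v))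
    {s t : ℝ} (hst : s ≠ t) {k : T.domain} {w e : H}
    (hk : T k - (s : ℂ) • (k : H) = (s : ℂ) • w) (he : e ∈ eigenspace T (t : ℂ))
    (hew : inner ℂ e w = 0) : inner ℂ e (k : H) = 0 := by
  obtain ⟨hed, he⟩ := he
  have h := hT ⟨e, hed⟩ k
  rw [he, sub_eq_iff_eq_add.1 hk, inner_add_right, inner_smul_left, inner_smul_right,
    inner_smul_right, hew, Complex.conj_ofReal] at h
  have h1 : ((t : ℂ) - s) * inner ℂ e (k : H) = 0 := by linear_combination h
  refine (mul_eq_zero.1 h1).resolve_left ?_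
  rw [← Complex.ofReal_sub]
  exact_mod_cast sub_ne_zero.2 hst.symm

/-- The difference identity for `t ↦ t (w, u_t)`, `u_t = w + k_t`, `(T - t) k_t = t w`. -/
theorem mul_inner_sub_mul_inner
    (hT : ∀ u v : T.domain, inner ℂ (T u) (v : H) = inner ℂ (u : H) (T v))
    {s t : ℝ} {w : H} {k l : T.domain} (hk : T k - (s : ℂ) • (k : H) = (s : ℂ) • w)
    (hl : T l - (t : ℂ) • (l : H) = (t : ℂ) • w) :
    t * (inner ℂ w (w + l)).re - s * (inner ℂ w (w + k)).re =
      (t - s) * (inner ℂ (w + k) (w + l)).re := by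
  have h := congrArg Complex.re (hT k l)
  rw [sub_eq_iff_eq_add.1 hk, sub_eq_iff_eq_add.1 hl, inner_add_left, inner_add_right,
    inner_smul_left, inner_smul_left, inner_smul_right, inner_smul_right,
    Complex.conj_ofReal] at h
  have h2 := inner_re_symm (𝕜 := ℂ) (k : H) w
  simp only [Complex.add_re, Complex.re_ofReal_mul, RCLike.re_eq_complex_re] at h h2
  simp only [inner_add_left, inner_add_right, Complex.add_re]
  rw [h2] at h ⊢
  linarith

/-- The derivative is $\|w + l_t\|^2 > 0$, where $l_t$ is the solution orthogonal to $\ker(T - t)$.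
An arbitrary choice $k_t$ need not be continuous in $t$. -/
theorem strictMonoOn_mul_inner [CompleteSpace H]
    (hT : ∀ u v : T.domain, inner ℂ (T u) (v : H) = inner ℂ (u : H) (T v))
    (h0 : InResolventSet T 0) {Λ : Set ℝ} (hΛ : Λ.OrdConnected)
    (hess : ∀ t ∈ Λ, t ∉ essentialSpectrum T) {w : H} (hw0 : w ≠ 0)
    (hw : ∀ t ∈ Λ, w ∈ (eigenspace T (t : ℂ))ᗮ) {k : ℝ → T.domain}
    (hk : ∀ t ∈ Λ, T (k t) - (t : ℂ) • (k t : H) = (t : ℂ) • w) :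
    StrictMonoOn (fun t : ℝ => t * (inner ℂ w (w + k t)).re) Λ := by
  choose! K hK0 hKs hKb using fun t ht => exists_reduced_resolvent hT h0 (hess t ht)
  choose! l hlo hl using fun t ht => hKs t ht _ (Submodule.smul_mem _ (t : ℂ) (hw t ht))
  -- The difference $l_t - k_t$ lies in $\ker(T - t)$, to which $w$ is orthogonal.
  have hphi : Set.EqOn (fun t : ℝ => t * (inner ℂ w (w + k t)).re)
      (fun t : ℝ => t * (inner ℂ w (w + l t)).re) Λ := by
    intro t ht
    have h1 : ((l t - k t : T.domain) : H) ∈ eigenspace T (t : ℂ) := by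
      rw [mem_eigenspace_coe, T.map_sub, Submodule.coe_sub, smul_sub]
      have := hk t ht
      rw [← hl t ht] at this
      linear_combination (norm := module) -this
    have h2 : inner ℂ w (l t : H) = inner ℂ w (k t : H) := by
      rw [← sub_eq_zero, ← inner_sub_right]
      exact Submodule.inner_left_of_mem_orthogonal h1 (hw t ht)
    simp only [inner_add_right, h2]
  refine StrictMonoOn.congr ?_ hphi.symm
  have hne (t) (ht : t ∈ Λ) : w + l t ≠ 0 := by
    intro h
    have h1 : T (l t) = 0 := by
      rw [sub_eq_iff_eq_add.1 (hl t ht), ← smul_add, h, smul_zero]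
    obtain ⟨R, -, hR⟩ := h0
    have h2 := hR (l t)
    rw [h1, zero_smul, sub_zero, map_zero] at h2
    rw [← h2, add_zero] at h
    exact hw0 h
  have hbound (t) (ht : t ∈ Λ) (s) (hs : s ∈ Λ) :
      ‖(w + l s) - (w + l t)‖ ≤ K t * (|s - t| * ‖w + l s‖) := by
    by_cases hst : s = t
    · subst hst; simp
    have ho : ((l s - l t : T.domain) : H) ∈ (eigenspace T (t : ℂ))ᗮ :=
      Submodule.sub_mem _ (fun e he =>
        inner_eq_zero_of_mem_eigenspace hT hst (hl s hs) he (hw t ht e he)) (hlo t ht)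
    -- Subtracting the equations gives $(T - t)(l_s - l_t) = (s - t)(w + l_s)$.
    have h1 : T (l s - l t) - (t : ℂ) • ((l s - l t : T.domain) : H) =
        ((s - t : ℝ) : ℂ) • (w + l s) := by
      rw [T.map_sub, sub_eq_iff_eq_add.1 (hl s hs), sub_eq_iff_eq_add.1 (hl t ht),
        Submodule.coe_sub]
      push_cast
      module
    have h2 := hKb t ht _ ho
    rw [h1, norm_smul, Complex.norm_real, Real.norm_eq_abs] at h2
    rwa [add_sub_add_left_eq_sub, ← Submodule.coe_sub]
  have hcont (t) (ht : t ∈ Λ) : Tendsto (fun s => w + (l s : H)) (𝓝[Λ] t) (𝓝 (w + l t)) := by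
    -- The factor $1/2$ lets $\|w + l_s\|$ be absorbed, so $\|w + l_s\| \le 2\|w + l_t\|$ near $t$.
    have hsmall : ∀ᶠ s in 𝓝[Λ] t, K t * |s - t| < 1 / 2 := by
      have : Tendsto (fun s => K t * |s - t|) (𝓝 t) (𝓝 (K t * |t - t|)) :=
        Continuous.tendsto (by fun_prop) t
      exact (this.mono_left nhdsWithin_le_nhds).eventually (gt_mem_nhds (by simp))
    rw [tendsto_iff_norm_sub_tendsto_zero]
    have hlim : Tendsto (fun s => K t * (|s - t| * (2 * ‖w + l t‖))) (𝓝[Λ] t) (𝓝 0) := by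
      have : Tendsto (fun s => K t * (|s - t| * (2 * ‖w + l t‖))) (𝓝 t)
          (𝓝 (K t * (|t - t| * (2 * ‖w + l t‖)))) :=
        Continuous.tendsto (by fun_prop) t
      simpa using this.mono_left nhdsWithin_le_nhds
    refine squeeze_zero' (Eventually.of_forall fun s => norm_nonneg _) ?_ hlim
    filter_upwards [hsmall, self_mem_nhdsWithin] with s hs hsΛ
    have h1 := hbound t ht s hsΛ
    have h2 : ‖w + l s‖ ≤ 2 * ‖w + l t‖ := by
      have h3 := norm_sub_norm_le (w + (l s : H)) (w + l t)
      nlinarith [norm_nonneg (w + (l s : H))]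
    refine h1.trans ?_
    have := hK0 t ht
    gcongr
  have hderiv (t) (ht : t ∈ Λ) : HasDerivWithinAt (fun t : ℝ => t * (inner ℂ w (w + l t)).re)
      (‖w + l t‖ ^ 2) Λ t := by
    rw [hasDerivWithinAt_iff_tendsto_slope]
    have h1 : Tendsto (fun s => (inner ℂ (w + l t) (w + (l s : H))).re) (𝓝[Λ \ {t}] t)
        (𝓝 (‖w + l t‖ ^ 2)) := by
      have h2 : (‖w + (l t : H)‖ ^ 2 : ℝ) = (inner ℂ (w + l t) (w + (l t : H))).re := by
        rw [inner_self_eq_norm_sq_to_K]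
        norm_cast
      rw [h2]
      have h3 := (hcont t ht).mono_left (nhdsWithin_mono t (Set.sdiff_subset (t := {t})))
      exact (Complex.continuous_re.tendsto _).comp (tendsto_const_nhds.inner h3)
    refine h1.congr' ?_
    filter_upwards [self_mem_nhdsWithin] with s hs
    have hst : s - t ≠ 0 := sub_ne_zero.2 hs.2
    rw [slope_def_field, mul_inner_sub_mul_inner hT (hl t ht) (hl s hs.1)]
    field_simp
  refine strictMonoOn_of_hasDerivWithinAt_pos hΛ.convex
    (fun t ht => (hderiv t ht).continuousWithinAt)
    (fun t ht => (hderiv t (interior_subset ht)).mono interior_subset) fun t ht => ?_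
  have := norm_pos_iff.2 (hne t (interior_subset ht))
  positivity

end Symmetric

/-- The Riesz representation theorem for an inner product given by `InnerProductSpace.Core`. -/
theorem exists_core_inner_eq {V : Type*} [AddCommGroup V] [Module ℂ V]
    (cd : InnerProductSpace.Core ℂ V)
    (hcomplete : ∀ x : ℕ → V,
      (∀ ε > 0, ∃ N, ∀ m ≥ N, ∀ n ≥ N, (cd.inner (x m - x n) (x m - x n)).re < ε) →
      ∃ u, Tendsto (fun n => (cd.inner (x n - u) (x n - u)).re) atTop (𝓝 0))
    (L : V →ₗ[ℂ] ℂ) {M : ℝ} (hM : 0 ≤ M) (hL : ∀ v, ‖L v‖ ^ 2 ≤ M * (cd.inner v v).re) :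
    ∃ u, ∀ v, cd.inner u v = L v := by
  -- The space $V$ is abstract so that the form norm does not clash with the norm a form domain
  -- inherits from $H$.
  let _ : NormedAddCommGroup V := cd.toNormedAddCommGroup
  let _ : InnerProductSpace ℂ V := InnerProductSpace.ofCore cd.toCore
  have hnorm (u : V) : (cd.inner u u).re = ‖u‖ ^ 2 := by
    have h : cd.inner u u = (‖u‖ : ℂ) ^ 2 := inner_self_eq_norm_sq_to_K (𝕜 := ℂ) u
    rw [h]
    norm_cast
  simp only [hnorm] at hcomplete hL
  have : CompleteSpace V := by
    refine Metric.complete_of_cauchySeq_tendsto fun x hx => ?_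
    obtain ⟨u, hu⟩ := hcomplete x fun ε hε => by
      obtain ⟨N, hN⟩ := Metric.cauchySeq_iff.1 hx (√ε) (Real.sqrt_pos.2 hε)
      refine ⟨N, fun m hm n hn => ?_⟩
      have h1 := hN m hm n hn
      rwa [dist_eq_norm, Real.lt_sqrt (norm_nonneg _)] at h1
    refine ⟨u, tendsto_iff_norm_sub_tendsto_zero.2 ?_⟩
    simpa using hu.sqrt
  let L' : V →L[ℂ] ℂ := L.mkContinuous (√M) fun v => by
    refine le_of_sq_le_sq ?_ (by positivity)
    rw [mul_pow, Real.sq_sqrt hM]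
    exact hL v
  exact ⟨(InnerProductSpace.toDual ℂ V).symm L', fun v =>
    InnerProductSpace.toDual_symm_apply (x := v) (y := L')⟩

/-! ### Operators generated by forms -/

namespace FormPair

variable (F : FormPair H)

theorem formDomain_le (B : BC) : F.formDomain B ≤ F.H1 := by
  cases B
  · exact le_rfl
  · exact F.H01_le

theorem dense_formDomain (B : BC) : Dense (F.formDomain B : Set H) := by
  cases B
  · exact F.dense_H1
  · exact F.dense_H01

theorem H01_le_formDomain (B : BC) : F.H01 ≤ F.formDomain B := by
  cases B
  · exact F.H01_le
  · exact le_rfl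

theorem mem_formDomain_of_tendsto (B : BC) (x : ℕ → F.H1) (u : F.H1)
    (hx : ∀ n, (x n : H) ∈ F.formDomain B)
    (h : Tendsto (fun n => (F.a (x n - u) (x n - u)).re) atTop (𝓝 0)) :
    (u : H) ∈ F.formDomain B := by
  cases B
  · exact u.2
  · exact F.closed_H01 x u hx h

theorem mem_formDomain_of_mem_domain (B : BC) {u : H} (hu : u ∈ (F.opB B).domain) :
    u ∈ F.formDomain B := by
  obtain ⟨p, ⟨hpQ, -⟩, rfl⟩ := hu
  exact hpQ

theorem a_opB (B : BC) (u : (F.opB B).domain) (hu : (u : H) ∈ F.H1) (v : F.H1)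
    (hv : (v : H) ∈ F.formDomain B) : F.a ⟨u, hu⟩ v = inner ℂ (F.opB B u) (v : H) := by
  have h : ((u : H), F.opB B u) ∈ (F.formOperator (F.formDomain B) (F.formDomain B)).graph :=
    (F.opB B).mem_graph u
  rw [F.graph_formOperator _ _ (F.formDomain_le B) (F.dense_formDomain B)] at h
  exact h.2.2 v hv

theorem exists_opB_eq (B : BC) {u : F.H1} (hu : (u : H) ∈ F.formDomain B) {f : H}
    (h : ∀ v : F.H1, (v : H) ∈ F.formDomain B → F.a u v = inner ℂ f (v : H)) :
    ∃ u' : (F.opB B).domain, (u' : H) = u ∧ F.opB B u' = f := by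
  have hg : ((u : H), f) ∈ (F.opB B).graph := by
    rw [opB, F.graph_formOperator _ _ (F.formDomain_le B) (F.dense_formDomain B)]
    exact ⟨hu, u.2, h⟩
  exact (LinearPMap.mem_graph_iff _).1 hg

theorem a_opA (u : F.opA.domain) (hu : (u : H) ∈ F.H1) (v : F.H1) (hv : (v : H) ∈ F.H01) :
    F.a ⟨u, hu⟩ v = inner ℂ (F.opA u) (v : H) := by
  have h : ((u : H), F.opA u) ∈ (F.formOperator F.H1 F.H01).graph := F.opA.mem_graph u
  rw [F.graph_formOperator _ _ F.H01_le F.dense_H01] at h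
  exact h.2.2 v hv

/-- Both operators represent the same functional on the dense subspace $H^1_0$, so $A$ extends
$A_B$. -/
theorem opA_inclusion (B : BC) (u : (F.opB B).domain) :
    F.opA (Submodule.inclusion (F.domain_opB_le B) u) = F.opB B u := by
  have hu : (u : H) ∈ F.H1 := F.domain_opA_le (F.domain_opB_le B u.2)
  refine F.dense_H01.eq_of_inner_left ℂ fun v hv => ?_
  rw [← F.a_opB B u hu ⟨v, F.H01_le hv⟩ (F.H01_le_formDomain B hv)]
  exact (F.a_opA (Submodule.inclusion (F.domain_opB_le B) u) hu ⟨v, F.H01_le hv⟩ hv).symm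

theorem opB_symmetric (B : BC) (u v : (F.opB B).domain) :
    inner ℂ (F.opB B u) (v : H) = inner ℂ (u : H) (F.opB B v) := by
  have hu := F.domain_opA_le (F.domain_opB_le B u.2)
  have hv := F.domain_opA_le (F.domain_opB_le B v.2)
  rw [← inner_conj_symm (u : H),
    ← F.a_opB B u hu ⟨v, hv⟩ (F.mem_formDomain_of_mem_domain B v.2),
    ← F.a_opB B v hv ⟨u, hu⟩ (F.mem_formDomain_of_mem_domain B u.2), F.hermitian]
  rfl

/-- The form as an inner product on its domain. -/
@[reducible] def core (B : BC) :
    InnerProductSpace.Core ℂ ((F.formDomain B).comap F.H1.subtype) where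
  inner u v := F.a u v
  conj_inner_symm u v := (F.hermitian u v).symm
  re_inner_nonneg u := by
    obtain ⟨c, hc, h⟩ := F.positive
    exact (by positivity : (0 : ℝ) ≤ c * ‖((u : F.H1) : H)‖ ^ 2).trans (h u)
  add_left u v w := by simp
  smul_left u v c := by simp
  definite u hu := by
    obtain ⟨c, hc, h⟩ := F.positive
    have h1 := h u
    rw [hu, Complex.zero_re] at h1
    have h2 : ‖((u : F.H1) : H)‖ ^ 2 ≤ 0 := by nlinarith
    have h3 : ((u : F.H1) : H) = 0 := by
      rw [← norm_eq_zero]; nlinarith [norm_nonneg ((u : F.H1) : H)]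
    exact Subtype.ext (Subtype.ext h3)

/-- The Riesz representation theorem in the form domain. -/
theorem exists_a_eq_inner [CompleteSpace H] (B : BC) (f : H) :
    ∃ u : F.H1, (u : H) ∈ F.formDomain B ∧
      ∀ v : F.H1, (v : H) ∈ F.formDomain B → F.a u v = inner ℂ f (v : H) := by
  obtain ⟨c, hc, hpos⟩ := F.positive
  suffices h : ∃ u, ∀ v, (F.core B).inner u v = inner ℂ f ((v : F.H1) : H) by
    obtain ⟨u, hu⟩ := h
    exact ⟨u, u.2, fun v hv => hu ⟨v, hv⟩⟩
  refine exists_core_inner_eq (F.core B) (fun x hx => ?_)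
    ((innerSL ℂ f).toLinearMap.comp
      (F.H1.subtype.comp ((F.formDomain B).comap F.H1.subtype).subtype))
    -- Cauchy–Schwarz and coercivity: $|(f,v)|^2 \le \|f\|^2\|v\|^2 \le \|f\|^2 c^{-1} a[v,v]$.
    (M := ‖f‖ ^ 2 * c⁻¹) (by positivity) (fun v => ?_)
  · have hx' : CauchySeq fun n => ((x n : F.H1) : H) := by
      refine Metric.cauchySeq_iff.2 fun ε hε => ?_
      obtain ⟨N, hN⟩ := hx (c * ε ^ 2) (by positivity)
      refine ⟨N, fun m hm n hn => ?_⟩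
      have h1 := (hpos (x m - x n)).trans_lt (hN m hm n hn)
      rw [dist_eq_norm]
      exact lt_of_pow_lt_pow_left₀ 2 hε.le (lt_of_mul_lt_mul_left h1 hc.le)
    obtain ⟨y, hy⟩ := cauchySeq_tendsto_of_complete hx'
    obtain ⟨u, -, hu⟩ := F.closed (fun n => x n) y hy hx
    exact ⟨⟨u, F.mem_formDomain_of_tendsto B (fun n => x n) u (fun n => (x n).2) hu⟩, hu⟩
  · have h1 : ‖inner ℂ f ((v : F.H1) : H)‖ ^ 2 ≤ ‖f‖ ^ 2 * ‖((v : F.H1) : H)‖ ^ 2 := by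
      rw [← mul_pow]
      gcongr
      exact norm_inner_le_norm _ _
    refine h1.trans ?_
    rw [mul_assoc]
    gcongr
    rw [inv_mul_eq_div, le_div_iff₀ hc, mul_comm]
    exact hpos v

/-- Riesz representation in the form norm gives surjectivity; coercivity gives $c\|u\| \le \|A_B
u\|$, hence injectivity and the bound $c^{-1}$ for the inverse. -/
theorem inResolventSet_zero [CompleteSpace H] (B : BC) : InResolventSet (F.opB B) 0 := by
  have hex (f : H) : ∃ u : (F.opB B).domain, F.opB B u = f := by
    obtain ⟨u, hu, h⟩ := F.exists_a_eq_inner B f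
    obtain ⟨u', -, h'⟩ := F.exists_opB_eq B hu h
    exact ⟨u', h'⟩
  obtain ⟨c, hc, hpos⟩ := F.positive
  have hbound (u : (F.opB B).domain) : c * ‖(u : H)‖ ≤ ‖F.opB B u‖ := by
    have hu := F.domain_opA_le (F.domain_opB_le B u.2)
    have h1 := hpos ⟨u, hu⟩
    rw [F.a_opB B u hu ⟨u, hu⟩ (F.mem_formDomain_of_mem_domain B u.2)] at h1
    have h2 := (Complex.re_le_norm _).trans (norm_inner_le_norm (𝕜 := ℂ) (F.opB B u) (u : H))
    rcases (norm_nonneg (u : H)).eq_or_lt with h3 | h3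
    · rw [← h3, mul_zero]; positivity
    · refine le_of_mul_le_mul_right ?_ h3
      calc c * ‖(u : H)‖ * ‖(u : H)‖ = c * ‖(u : H)‖ ^ 2 := by ring
        _ ≤ _ := h1.trans h2
  have hinj (u v : (F.opB B).domain) (h : F.opB B u = F.opB B v) : u = v := by
    have h1 := hbound (u - v)
    rw [LinearPMap.map_sub, h, sub_self, norm_zero] at h1
    have h2 : ‖((u - v : (F.opB B).domain) : H)‖ = 0 := by
      nlinarith [norm_nonneg ((u - v : (F.opB B).domain) : H)]
    exact sub_eq_zero.1 (Subtype.ext (norm_eq_zero.1 h2))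
  choose r hr using hex
  let R : H →ₗ[ℂ] H :=
    { toFun := fun f => r f
      map_add' := fun f g => by
        rw [← Submodule.coe_add]
        congr 1
        exact hinj _ _ (by rw [LinearPMap.map_add, hr, hr, hr])
      map_smul' := fun z f => by
        rw [RingHom.id_apply, ← Submodule.coe_smul]
        congr 1
        exact hinj _ _ (by rw [LinearPMap.map_smul, hr, hr]) }
  refine ⟨R.mkContinuous c⁻¹ fun f => ?_, fun f => ⟨r f, rfl, ?_⟩, fun u => ?_⟩
  · have := hbound (r f)
    rw [hr] at this
    rw [inv_mul_eq_div, le_div_iff₀ hc, mul_comm]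
    exact this
  · rw [hr, zero_smul, sub_zero]
  · rw [zero_smul, sub_zero]
    exact congrArg Subtype.val (hinj _ _ (hr (F.opB B u)))

/-! ### The vectors $P'_B(t)v$ and the values of $b$ on them -/

theorem zero_notMem_essentialSpectrum [CompleteSpace H] (B : BC) :
    (0 : ℝ) ∉ essentialSpectrum (F.opB B) := fun h =>
  h.1 (by simpa using F.inResolventSet_zero B)

/-- `w = P'_B(0) v` satisfies `A w = 0`. -/
theorem opA_P'_zero [CompleteSpace H] (B : BC) (v : F.opA.domain) :
    F.opA (F.P' B 0 v) = 0 := by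
  have h := reducedResolvent_spec (F.opB_symmetric B) (F.inResolventSet_zero B)
    (F.zero_notMem_essentialSpectrum B) (F.opA v)
  have hker : kerProj (F.opB B) ((0 : ℝ) : ℂ) (F.opA v) = 0 := by
    rw [kerProj, orthProj_eq_zero_iff]
    rintro e ⟨he, he'⟩
    obtain ⟨R, -, hR⟩ := F.inResolventSet_zero B
    have h1 := hR ⟨e, he⟩
    rw [he', Complex.ofReal_zero, sub_self, map_zero] at h1
    rw [show e = 0 from h1.symm, inner_zero_left]
  rw [hker] at h
  simp only [Complex.ofReal_zero, zero_smul, sub_zero] at h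
  rw [P', LinearPMap.map_sub, P, opA_inclusion, zero_smul, sub_zero, h, sub_self]

/-- If `w = P'_B(0) v` is orthogonal to `ker (A_B - t)`, then `P'_B(t) v = w + k` with
`(A_B - t) k = t w`. -/
theorem exists_P'_eq [CompleteSpace H] (B : BC) (v : F.opA.domain) {t : ℝ}
    (ht : t ∉ essentialSpectrum (F.opB B))
    (hw : (F.P' B 0 v : H) ∈ (eigenspace (F.opB B) (t : ℂ))ᗮ) :
    ∃ k : (F.opB B).domain,
      F.P' B t v = F.P' B 0 v + Submodule.inclusion (F.domain_opB_le B) k ∧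
      F.opB B k - (t : ℂ) • (k : H) = (t : ℂ) • (F.P' B 0 v : H) := by
  set w := F.P' B 0 v with hwdef
  set g := reducedResolvent (F.opB B) 0 (F.opA v - (0 : ℂ) • (v : H)) with hg
  have hv : v = w + Submodule.inclusion (F.domain_opB_le B) g := by
    rw [hwdef, P', P, sub_add_cancel]
  set r := reducedResolvent (F.opB B) t (F.opA v - (t : ℂ) • (v : H)) with hr
  have hr' := reducedResolvent_spec (F.opB_symmetric B) (F.inResolventSet_zero B) ht
    (F.opA v - (t : ℂ) • (v : H))
  rw [← hr] at hr'
  have hAv : F.opA v - (t : ℂ) • (v : H) =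
      (F.opB B g - (t : ℂ) • (g : H)) - (t : ℂ) • (w : H) := by
    have h0 : F.opA w = 0 := F.opA_P'_zero B v
    rw [hv, LinearPMap.map_add, h0, opA_inclusion, Submodule.coe_add, Submodule.coe_inclusion]
    module
  -- Since $Av - tv = (A_B - t)g - tw$ is already orthogonal to the kernel, the projection $E'_B(t)$
  -- acts trivially.
  have hker : kerProj (F.opB B) (t : ℂ) (F.opA v - (t : ℂ) • (v : H)) = 0 := by
    rw [kerProj, orthProj_eq_zero_iff, hAv]
    refine Submodule.sub_mem _ ?_ (Submodule.smul_mem _ _ hw)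
    rintro e ⟨he, he'⟩
    have h1 := F.opB_symmetric B ⟨e, he⟩ g
    rw [he', inner_smul_left, Complex.conj_ofReal] at h1
    rw [inner_sub_right, inner_smul_right, ← h1, sub_self]
  rw [hker, sub_zero, hAv] at hr'
  refine ⟨g - r, ?_, ?_⟩
  · rw [P', P, ← hr, map_sub]
    nth_rewrite 1 [hv]
    abel
  · rw [LinearPMap.map_sub, Submodule.coe_sub]
    linear_combination (norm := module) -hr'

theorem opA_eq_smul (B : BC) {w : F.opA.domain} (hw : F.opA w = 0) {t : ℝ}
    {k : (F.opB B).domain} (hk : F.opB B k - (t : ℂ) • (k : H) = (t : ℂ) • (w : H)) :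
    F.opA (w + Submodule.inclusion (F.domain_opB_le B) k) = (t : ℂ) • ((w : H) + k) := by
  rw [LinearPMap.map_add, hw, opA_inclusion, sub_eq_iff_eq_add.1 hk, smul_add, zero_add]

/-- With $u = w + k$, the identity $a[k,x] = t(u,x)$ holds for all $x \in H^1$. Thus $a[k,u]$
cancels $(Au,u)$, and the cross term $a[w,k]$ contributes $t(w,u)$. -/
theorem bq_neumann {w : F.opA.domain} (hw : F.opA w = 0) {t : ℝ}
    {k : (F.opB .N).domain} (hk : F.opB .N k - (t : ℂ) • (k : H) = (t : ℂ) • (w : H)) :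
    F.bq (w + Submodule.inclusion (F.domain_opB_le .N) k) =
      F.a ⟨w, F.domain_opA_le w.2⟩ ⟨w, F.domain_opA_le w.2⟩ +
        t * inner ℂ (w : H) ((w : H) + k) := by
  have hwm := F.domain_opA_le w.2
  have hkm := F.domain_opA_le (F.domain_opB_le .N k.2)
  have hu := (w + Submodule.inclusion (F.domain_opB_le .N) k).2
  have h1 : (⟨_, F.domain_opA_le hu⟩ : F.H1) = ⟨w, hwm⟩ + ⟨k, hkm⟩ := rfl
  have h2 (x : F.H1) : F.a ⟨k, hkm⟩ x = inner ℂ (F.opB .N k) (x : H) :=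
    F.a_opB .N k hkm x x.2
  rw [bq, b, F.opA_eq_smul .N hw hk, h1, map_add F.a, LinearMap.add_apply, h2, map_add,
    F.hermitian ⟨w, hwm⟩ ⟨k, hkm⟩, h2, sub_eq_iff_eq_add.1 hk, ← smul_add]
  simp only [Submodule.coe_add, inner_smul_left, Complex.conj_ofReal, StarMul.star_mul,
    Complex.star_def, inner_conj_symm]
  ring

/-- Now $k \in H^1_0$, so $Aw = 0$ kills both cross terms. What remains besides $a[w,w]$ is $a[k,k]
- t(u,u) = t(u,k) - t(u,u) = -t(u,w)$. -/
theorem bq_dirichlet {w : F.opA.domain} (hw : F.opA w = 0) {t : ℝ}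
    {k : (F.opB .D).domain} (hk : F.opB .D k - (t : ℂ) • (k : H) = (t : ℂ) • (w : H)) :
    F.bq (w + Submodule.inclusion (F.domain_opB_le .D) k) =
      F.a ⟨w, F.domain_opA_le w.2⟩ ⟨w, F.domain_opA_le w.2⟩ -
        t * inner ℂ ((w : H) + k) (w : H) := by
  have hwm := F.domain_opA_le w.2
  have hkm := F.domain_opA_le (F.domain_opB_le .D k.2)
  have hk0 : (k : H) ∈ F.H01 := F.mem_formDomain_of_mem_domain .D k.2
  have hu := (w + Submodule.inclusion (F.domain_opB_le .D) k).2
  have h1 : (⟨_, F.domain_opA_le hu⟩ : F.H1) = ⟨w, hwm⟩ + ⟨k, hkm⟩ := rfl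
  have h2 : F.a ⟨w, hwm⟩ ⟨k, hkm⟩ = 0 := by
    rw [F.a_opA w hwm ⟨k, hkm⟩ hk0, hw, inner_zero_left]
  have h3 : F.a ⟨k, hkm⟩ ⟨k, hkm⟩ = inner ℂ (F.opB .D k) (k : H) :=
    F.a_opB .D k hkm ⟨k, hkm⟩ hk0
  rw [bq, b, F.opA_eq_smul .D hw hk, h1, map_add F.a, LinearMap.add_apply, map_add, map_add, h2,
    F.hermitian ⟨k, hkm⟩ ⟨w, hwm⟩, h2, h3, sub_eq_iff_eq_add.1 hk, ← smul_add]
  simp only [Submodule.coe_add, inner_smul_left, inner_add_right, Complex.conj_ofReal, star_zero]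
  ring

theorem a_self_im (u : F.H1) : (F.a u u).im = 0 :=
  Complex.conj_eq_iff_im.1 (F.hermitian u u).symm

/-- `t (w, w + k)` is real if `(A_B - t) k = t w`. -/
theorem mul_inner_im (B : BC) {w : H} {t : ℝ} {k : (F.opB B).domain}
    (hk : F.opB B k - (t : ℂ) • (k : H) = (t : ℂ) • w) :
    ((t : ℂ) * inner ℂ w (w + k)).im = 0 := by
  have h1 : (t : ℂ) * inner ℂ w (w + k) =
      t * inner ℂ w w + inner ℂ (F.opB B k) (k : H) - t * inner ℂ (k : H) (k : H) := by
    rw [sub_eq_iff_eq_add.1 hk, inner_add_left, inner_smul_left, inner_smul_left,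
      inner_add_right, Complex.conj_ofReal]
    ring
  have h2 : (inner ℂ (F.opB B k) (k : H)).im = 0 := by
    refine Complex.conj_eq_iff_im.1 ?_
    rw [inner_conj_symm, F.opB_symmetric]
  have h3 (x : H) : (inner ℂ x x).im = 0 := inner_self_im (𝕜 := ℂ) x
  rw [h1]
  simp only [Complex.add_im, Complex.sub_im, Complex.im_ofReal_mul, h2, h3, mul_zero, add_zero,
    sub_zero]

theorem P'_mem_G [CompleteSpace H] (B : BC) {v : F.opA.domain} {t : ℝ} {k : (F.opB B).domain}
    (hP : F.P' B t v = F.P' B 0 v + Submodule.inclusion (F.domain_opB_le B) k)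
    (hk : F.opB B k - (t : ℂ) • (k : H) = (t : ℂ) • (F.P' B 0 v : H)) :
    (F.P' B t v : H) ∈ F.G (t : ℂ) := by
  rw [G, mem_eigenspace_coe, hP]
  exact F.opA_eq_smul B (F.opA_P'_zero B v) hk

/-- The common description of `P'_B(t) v` for `t ∈ Λ`. -/
theorem exists_P'_family [CompleteSpace H] (B : BC) {Λ : Set ℝ} (hΛ : Λ.OrdConnected)
    (v : F.opA.domain) (hess : Λ ∩ essentialSpectrum (F.opB B) = ∅)
    (hχ : spectralProjection (F.opB B) Λ (F.P' B 0 v : H) = 0) :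
    ∃ k : ℝ → (F.opB B).domain,
      (∀ t ∈ Λ, F.P' B t v = F.P' B 0 v + Submodule.inclusion (F.domain_opB_le B) (k t)) ∧
      (∀ t ∈ Λ, F.opB B (k t) - (t : ℂ) • (k t : H) = (t : ℂ) • (F.P' B 0 v : H)) ∧
      MonotoneOn (fun t : ℝ => t * (inner ℂ (F.P' B 0 v : H) ((F.P' B 0 v : H) + k t)).re) Λ ∧
      ((v : H) ∉ (F.opB B).domain → StrictMonoOn
        (fun t : ℝ => t * (inner ℂ (F.P' B 0 v : H) ((F.P' B 0 v : H) + k t)).re) Λ) := by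
  have hess' (t) (ht : t ∈ Λ) : t ∉ essentialSpectrum (F.opB B) := fun h =>
    (hess ▸ (⟨ht, h⟩ : t ∈ Λ ∩ essentialSpectrum (F.opB B)) : t ∈ (∅ : Set ℝ))
  have hw (t) (ht : t ∈ Λ) : (F.P' B 0 v : H) ∈ (eigenspace (F.opB B) (t : ℂ))ᗮ :=
    mem_orthogonal_eigenspace_of_spectralProjection_eq_zero hχ ht
  choose! k hk hk' using fun t (ht : t ∈ Λ) => F.exists_P'_eq B v (hess' t ht) (hw t ht)
  have hstrict (hw0 : (F.P' B 0 v : H) ≠ 0) := strictMonoOn_mul_inner (F.opB_symmetric B)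
    (F.inResolventSet_zero B) hΛ hess' hw0 hw hk'
  refine ⟨k, hk, hk', ?_, fun hv => hstrict fun h => hv ?_⟩
  · by_cases hw0 : (F.P' B 0 v : H) = 0
    · simp only [hw0, inner_zero_left, Complex.zero_re, mul_zero]
      exact monotoneOn_const
    · exact (hstrict hw0).monotoneOn
  -- If $w = 0$, then $v = P_B(0)v$, a value of the reduced resolvent, so $v \in D(A_B)$.
  · rw [P', Submodule.coe_sub, sub_eq_zero] at h
    rw [h]
    exact Subtype.property (reducedResolvent (F.opB B) 0 _)

end FormPair

end DirichletNeumann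
end

theorem mainTheorem9 {H : Type*} [NormedAddCommGroup H] [InnerProductSpace ℂ H] [CompleteSpace H]
    [TopologicalSpace.SeparableSpace H] (hH : ¬ FiniteDimensional ℂ H)
    (F : DirichletNeumann.FormPair H) (Λ : Set ℝ) (hΛ : Λ.OrdConnected) (v : F.opA.domain) :
    (Λ ∩ DirichletNeumann.essentialSpectrum (F.opB .N) = ∅ →
      DirichletNeumann.spectralProjection (F.opB .N) Λ (F.P' .N 0 v : H) = 0 →
      (∀ t ∈ Λ, (F.P' .N (t : ℂ) v : H) ∈ F.G (t : ℂ)) ∧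
      (∀ t ∈ Λ, (F.bq (F.P' .N (t : ℂ) v)).im = 0) ∧
      MonotoneOn (fun t : ℝ => (F.bq (F.P' .N (t : ℂ) v)).re) Λ ∧
      ((v : H) ∉ (F.opB .N).domain →
        StrictMonoOn (fun t : ℝ => (F.bq (F.P' .N (t : ℂ) v)).re) Λ)) ∧
    (Λ ∩ DirichletNeumann.essentialSpectrum (F.opB .D) = ∅ →
      DirichletNeumann.spectralProjection (F.opB .D) Λ (F.P' .D 0 v : H) = 0 →
      (∀ t ∈ Λ, (F.P' .D (t : ℂ) v : H) ∈ F.G (t : ℂ)) ∧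
      (∀ t ∈ Λ, (F.bq (F.P' .D (t : ℂ) v)).im = 0) ∧
      AntitoneOn (fun t : ℝ => (F.bq (F.P' .D (t : ℂ) v)).re) Λ ∧
      ((v : H) ∉ (F.opB .D).domain →
        StrictAntiOn (fun t : ℝ => (F.bq (F.P' .D (t : ℂ) v)).re) Λ)) := by

  open DirichletNeumann FormPair in
  constructor
  · intro hess hχ
    obtain ⟨k, hP, hk, hmono, hstrict⟩ := F.exists_P'_family .N hΛ v hess hχ
    have hbq (t : ℝ) (ht : t ∈ Λ) := hP t ht ▸ F.bq_neumann (F.opA_P'_zero .N v) (hk t ht)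
    have hre : Set.EqOn (fun t : ℝ => (F.bq (F.P' .N (t : ℂ) v)).re)
        (fun t : ℝ => (F.a ⟨_, F.domain_opA_le (F.P' .N 0 v).2⟩
          ⟨_, F.domain_opA_le (F.P' .N 0 v).2⟩).re +
          t * (inner ℂ (F.P' .N 0 v : H) ((F.P' .N 0 v : H) + k t)).re) Λ := fun t ht => by
      simp only [hbq t ht, Complex.add_re, Complex.re_ofReal_mul]
    refine ⟨fun t ht => F.P'_mem_G .N (hP t ht) (hk t ht), fun t ht => ?_, ?_, fun hv => ?_⟩
    · rw [hbq t ht, Complex.add_im, F.a_self_im, F.mul_inner_im .N (hk t ht), add_zero]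
    · exact (hmono.const_add _).congr hre.symm
    · exact ((hstrict hv).const_add _).congr hre.symm
  · intro hess hχ
    obtain ⟨k, hP, hk, hmono, hstrict⟩ := F.exists_P'_family .D hΛ v hess hχ
    have hbq (t : ℝ) (ht : t ∈ Λ) := hP t ht ▸ F.bq_dirichlet (F.opA_P'_zero .D v) (hk t ht)
    have hre : Set.EqOn (fun t : ℝ => (F.bq (F.P' .D (t : ℂ) v)).re)
        (fun t : ℝ => (F.a ⟨_, F.domain_opA_le (F.P' .D 0 v).2⟩
          ⟨_, F.domain_opA_le (F.P' .D 0 v).2⟩).re -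
          t * (inner ℂ (F.P' .D 0 v : H) ((F.P' .D 0 v : H) + k t)).re) Λ := fun t ht => by
      have hsymm := inner_re_symm (𝕜 := ℂ) ((F.P' .D 0 v : H) + k t) (F.P' .D 0 v : H)
      simp only [RCLike.re_eq_complex_re] at hsymm
      simp only [hbq t ht, Complex.sub_re, Complex.re_ofReal_mul, hsymm]
    refine ⟨fun t ht => F.P'_mem_G .D (hP t ht) (hk t ht), fun t ht => ?_, ?_, fun hv => ?_⟩
    · have him := F.mul_inner_im .D (hk t ht)
      rw [← inner_conj_symm, Complex.im_ofReal_mul, Complex.conj_im, mul_neg, neg_eq_zero,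
        ← Complex.im_ofReal_mul] at him
      rw [hbq t ht, Complex.sub_im, F.a_self_im, him, sub_zero]
    · refine AntitoneOn.congr (fun s hs t ht hst => ?_) hre.symm
      exact sub_le_sub_left (hmono hs ht hst) _
    · refine StrictAntiOn.congr (fun s hs t ht hst => ?_) hre.symm
      exact sub_lt_sub_left (hstrict hv hs ht hst) _
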